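/- Let $n\ge 1$, let $\mathbb D^n=\{z\in\mathbb C^n: |z_k|<1,\ k=1,\dots,n\}$ be the unit polydisk and $\partial^*\mathbb D^n=\{z\in\mathbb C^n: |z_k|=1,\ k=1,\dots,n\}$ its distinguished boundary. Let $H(\mathbb D^n)$ be the set of holomorphic functions $f:\mathbb D^n\to\mathbb C$ and $H^\infty(\mathbb D^n)$ the set of bounded ones. For $f\in H(\mathbb D^n)$ and $z\in\mathbb D^n$ put $$Q_f(z)=\sup_{u\in\mathbb C^n\setminus\{0\}}\frac{\left|\sum_{k=1}^n\frac{\partial f}{\partial z_k}(z)\,u_k\right|}{H_z(u,\bar u)^{1/2}},\qquad H_z(u,\bar u)=\sum_{k=1}^n\frac{|u_k|^2}{(1-|z_k|^2)^2},$$ where $H_z$ is the (normalized) Bergman metric of $\mathbb D^n$, and $\beta_f=\sup_{z\in\mathbb D^n}Q_f(z)$. Let $\mathcal B(\mathbb D^n)=\{f\in H(\mathbb D^n):\beta_f<\infty\}$ be the Bloch space, with norm $\|f\|_{\mathcal B}=|f(0)|+\beta_f$, and let $$\mathcal B_{0^*}(\mathbb D^n)=\{f\in H(\mathbb D^n): Q_f(z)\to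 0 \text{ as } z\to\partial^*\mathbb D^n,\ z\in\mathbb D^n\}$$ be the $*$-little Bloch space, with the same norm. For $\psi\in H(\mathbb D^n)$, the multiplication operator $M_\psi f=\psi f$ is called bounded on one of these spaces $X$ if $\psi f\in X$ for all $f\in X$ and there is a finite constant $C$ with $\|\psi f\|_{\mathcal B}\le C\|f\|_{\mathcal B}$ for all $f\in X$. **Theorem.** Let $\psi\in H(\mathbb D^n)$. Then the following are equivalent: (a) $M_\psi$ is bounded on $\mathcal B(\mathbb D^n)$. (b) $M_\psi$ is bounded on $\mathcal B_{0^*}(\mathbb D^n)$. (c) $\psi\in H^\infty(\mathbb D^n)$ and $\displaystyle\sup_{z\in\mathbb D^n}\ \sum_{k=1}^n\log\frac{1+|z_k|}{1-|z_k|}\;Q_\psi(z)<\infty$. -/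

import Mathlib

open Filter Topology
open scoped ENNReal NNReal

noncomputable section

namespace PolydiskBloch

/-- The open unit polydisk `𝔻ⁿ` in `ℂⁿ`. -/
def polydisk (n : ℕ) : Set (Fin n → ℂ) := {z | ∀ k, ‖z k‖ < 1}

/-- The distinguished boundary `∂*𝔻ⁿ` of the polydisk: the torus `|z₁| = ⋯ = |zₙ| = 1`. -/
def distinguishedBoundary (n : ℕ) : Set (Fin n → ℂ) := {z | ∀ k, ‖z k‖ = 1}

/-- `H(𝔻ⁿ)`. Functions are total functions on `ℂⁿ`, but only their values on the (open) polydisk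
matter, here and in all the notions below. -/
def Holo (n : ℕ) : Set ((Fin n → ℂ) → ℂ) := {f | DifferentiableOn ℂ f (polydisk n)}

/-- `H^∞(𝔻ⁿ)`. -/
def HInfty (n : ℕ) : Set ((Fin n → ℂ) → ℂ) :=
  {f | f ∈ Holo n ∧ ∃ C : ℝ, ∀ z ∈ polydisk n, ‖f z‖ ≤ C}

/-- The Bergman metric `H_z(u, ū)` of the polydisk, normalized so that it is
`|u|² / (1 - |z|²)²` on the unit disk. -/
def bergman {n : ℕ} (z u : Fin n → ℂ) : ℝ := ∑ k, ‖u k‖ ^ 2 / (1 - ‖z k‖ ^ 2) ^ 2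

/-- `Q_f(z) = sup_{u ≠ 0} |∇f(z)u| / H_z(u, ū)^{1/2}`. For `z` in the polydisk the supremum is over
a bounded set, see `bddAbove_Q`. -/
def Q {n : ℕ} (f : (Fin n → ℂ) → ℂ) (z : Fin n → ℂ) : ℝ :=
  ⨆ u : {u : Fin n → ℂ // u ≠ 0}, ‖fderiv ℂ f z u‖ / √(bergman z u)

theorem bddAbove_Q {n : ℕ} (f : (Fin n → ℂ) → ℂ) {z : Fin n → ℂ} (hz : z ∈ polydisk n) :
    BddAbove (Set.range fun u : {u : Fin n → ℂ // u ≠ 0} =>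
      ‖fderiv ℂ f z u‖ / √(bergman z u)) := by
  refine ⟨‖fderiv ℂ f z‖, ?_⟩
  rintro _ ⟨⟨u, hu⟩, rfl⟩
  have key : ‖u‖ ≤ √(bergman z u) := by
    refine (pi_norm_le_iff_of_nonneg (Real.sqrt_nonneg _)).2 fun k => Real.le_sqrt_of_sq_le ?_
    have h1 : ‖u k‖ ^ 2 ≤ ‖u k‖ ^ 2 / (1 - ‖z k‖ ^ 2) ^ 2 := by
      have h2 : ‖z k‖ < 1 := hz k
      have h3 := norm_nonneg (z k)
      have h4 : 0 < 1 - ‖z k‖ ^ 2 := by nlinarith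
      refine le_div_self (by positivity) (by positivity) (pow_le_one₀ h4.le ?_)
      nlinarith
    refine h1.trans ?_
    exact Finset.single_le_sum (f := fun k => ‖u k‖ ^ 2 / (1 - ‖z k‖ ^ 2) ^ 2)
      (fun i _ => by positivity) (Finset.mem_univ k)
  have hpos : 0 < √(bergman z u) := (norm_pos_iff.2 hu).trans_le key
  refine (div_le_iff₀ hpos).2 (((fderiv ℂ f z).le_opNorm u).trans ?_)
  gcongr

/-- The Bloch seminorm `β_f = sup_{z ∈ 𝔻ⁿ} Q_f(z)`, possibly `∞`. -/
def blochSeminorm {n : ℕ} (f : (Fin n → ℂ) → ℂ) : ℝ≥0∞ :=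
  ⨆ z ∈ polydisk n, ENNReal.ofReal (Q f z)

/-- The Bloch norm `|f(0)| + β_f`. -/
def blochNorm {n : ℕ} (f : (Fin n → ℂ) → ℂ) : ℝ≥0∞ := ‖f 0‖ₑ + blochSeminorm f

/-- The Bloch space `𝓑(𝔻ⁿ)`. -/
def Bloch (n : ℕ) : Set ((Fin n → ℂ) → ℂ) := {f | f ∈ Holo n ∧ blochSeminorm f < ∞}

/-- The `*`-little Bloch space `𝓑_{0*}(𝔻ⁿ)`: holomorphic `f` with `Q_f(z) → 0` as `z ∈ 𝔻ⁿ`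
approaches the distinguished boundary. -/
def StarLittleBloch (n : ℕ) : Set ((Fin n → ℂ) → ℂ) :=
  {f | f ∈ Holo n ∧ Tendsto (Q f) (𝓝ˢ (distinguishedBoundary n) ⊓ 𝓟 (polydisk n)) (𝓝 0)}

/-- The multiplication operator `M_ψ : f ↦ ψ f` is bounded on the space `X`, with the Bloch norm:
it maps `X` into `X` and `‖ψ f‖ ≤ C ‖f‖` for a finite constant `C`. -/
def MulBoundedOn {n : ℕ} (ψ : (Fin n → ℂ) → ℂ) (X : Set ((Fin n → ℂ) → ℂ)) : Prop :=
  (∀ f ∈ X, ψ * f ∈ X) ∧ ∃ C : ℝ≥0, ∀ f ∈ X, blochNorm (ψ * f) ≤ C * blochNorm f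

end PolydiskBloch

end

noncomputable section

namespace PolydiskBloch

variable {n : ℕ}

/-! The product rule gives `Q (ψ * f) ≤ ‖ψ‖ * Q f + ‖f‖ * Q ψ`, together with a reverse form
isolating `‖f‖ * Q ψ`. Integrating `Q f` along radii shows that a Bloch function grows at most like
`logSum` (`norm_le_add_mul_logSum`), so (c) gives boundedness on the Bloch space.

Conversely, the powers `ψ ^ m` are iterates of the operator applied to `1`, and this growth bound
forces `ψ` to be bounded (`MulBoundedOn.exists_norm_le`). Logarithms peaking at a prescribed point,
with uniformly bounded norms, attain the growth rate and yield the weighted bound on `Q ψ`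
(`MulBoundedOn.bddAbove`). They lie in both spaces, so one argument serves (a) and (b).

For (c) ⇒ (b), the norm bound is inherited through `StarLittleBloch_subset_Bloch`. This inclusion is
not formal, since smallness of `Q f` near the torus says nothing directly about the rest of the
boundary; the maximum modulus principle transports it. Invariance holds because a `*`-little Bloch
function is, for every `δ > 0`, at most a constant plus `δ * logSum` near the torus
(`exists_norm_sub_le_logSum`). -/

/-! ### Pointwise estimates for `Q` and the product rule. -/

theorem isOpen_polydisk : IsOpen (polydisk n) := by
  simp only [polydisk, Set.ofPred_forall]
  exact isOpen_iInter_of_finite fun k => isOpen_lt (by fun_prop) continuous_const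

theorem Holo.differentiableAt {f : (Fin n → ℂ) → ℂ} (hf : f ∈ Holo n) {z : Fin n → ℂ}
    (hz : z ∈ polydisk n) : DifferentiableAt ℂ f z :=
  DifferentiableOn.differentiableAt hf (isOpen_polydisk.mem_nhds hz)

theorem Holo.mul {f g : (Fin n → ℂ) → ℂ} (hf : f ∈ Holo n) (hg : g ∈ Holo n) :
    f * g ∈ Holo n :=
  DifferentiableOn.mul hf hg

theorem one_sub_sq_pos {z : Fin n → ℂ} (hz : z ∈ polydisk n) (k : Fin n) :
    0 < 1 - ‖z k‖ ^ 2 := by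
  have h1 : ‖z k‖ < 1 := hz k
  nlinarith [norm_nonneg (z k)]

theorem Q_nonneg (f : (Fin n → ℂ) → ℂ) (z : Fin n → ℂ) : 0 ≤ Q f z :=
  Real.iSup_nonneg fun _ => by positivity

theorem norm_div_le_sqrt_bergman (z u : Fin n → ℂ) (k : Fin n) :
    ‖u k‖ / (1 - ‖z k‖ ^ 2) ≤ √(bergman z u) := by
  refine Real.le_sqrt_of_sq_le ?_
  rw [div_pow]
  exact Finset.single_le_sum (f := fun k => ‖u k‖ ^ 2 / (1 - ‖z k‖ ^ 2) ^ 2)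
    (fun i _ => by positivity) (Finset.mem_univ k)

theorem sqrt_bergman_le_sum {z : Fin n → ℂ} (hz : z ∈ polydisk n) (u : Fin n → ℂ) :
    √(bergman z u) ≤ ∑ k, ‖u k‖ / (1 - ‖z k‖ ^ 2) := by
  have h0 : ∀ k ∈ Finset.univ, 0 ≤ ‖u k‖ / (1 - ‖z k‖ ^ 2) := fun k _ =>
    div_nonneg (norm_nonneg _) (one_sub_sq_pos hz k).le
  refine Real.sqrt_le_iff.2 ⟨Finset.sum_nonneg h0, ?_⟩
  simp only [bergman, ← div_pow]
  exact Finset.sum_sq_le_sq_sum_of_nonneg h0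

theorem norm_fderiv_le_Q_mul {f : (Fin n → ℂ) → ℂ} {z : Fin n → ℂ} (hz : z ∈ polydisk n)
    (u : Fin n → ℂ) : ‖fderiv ℂ f z u‖ ≤ Q f z * √(bergman z u) := by
  by_cases hu : u = 0
  · simp only [hu, map_zero, norm_zero]
    exact mul_nonneg (Q_nonneg f z) (Real.sqrt_nonneg _)
  · obtain ⟨k, hk⟩ := Function.ne_iff.1 hu
    have hpos : 0 < √(bergman z u) :=
      (div_pos (norm_pos_iff.2 hk) (one_sub_sq_pos hz k)).trans_le
        (norm_div_le_sqrt_bergman z u k)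
    rw [← div_le_iff₀ hpos]
    exact le_ciSup (bddAbove_Q f hz) ⟨u, hu⟩

theorem Q_le_of_forall {f : (Fin n → ℂ) → ℂ} {z : Fin n → ℂ} {C : ℝ} (hC : 0 ≤ C)
    (h : ∀ u, ‖fderiv ℂ f z u‖ ≤ C * √(bergman z u)) : Q f z ≤ C :=
  Real.iSup_le (fun u => div_le_of_le_mul₀ (Real.sqrt_nonneg _) hC (h u)) hC

/-- Bounds for the partial derivatives control `Q`. -/
theorem Q_le_of_forall_single {f : (Fin n → ℂ) → ℂ} {z : Fin n → ℂ} (hz : z ∈ polydisk n)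
    {C : ℝ} (hC : 0 ≤ C)
    (h : ∀ k, (1 - ‖z k‖ ^ 2) * ‖fderiv ℂ f z (Pi.single k 1)‖ ≤ C) : Q f z ≤ n * C := by
  refine Q_le_of_forall (by positivity) fun u => ?_
  have hu : u = ∑ k, u k • (Pi.single k 1 : Fin n → ℂ) := by
    simpa [← Pi.single_smul] using (Finset.univ_sum_single u).symm
  conv_lhs => rw [hu, map_sum]
  calc ‖∑ k, fderiv ℂ f z (u k • (Pi.single k 1 : Fin n → ℂ))‖
      ≤ ∑ k : Fin n, C * √(bergman z u) := by
        refine norm_sum_le_of_le _ fun k _ => ?_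
        rw [map_smul, norm_smul]
        have hp := one_sub_sq_pos hz k
        calc ‖u k‖ * ‖fderiv ℂ f z (Pi.single k 1)‖
            = ((1 - ‖z k‖ ^ 2) * ‖fderiv ℂ f z (Pi.single k 1)‖) *
                (‖u k‖ / (1 - ‖z k‖ ^ 2)) := by field_simp
          _ ≤ C * √(bergman z u) :=
              mul_le_mul (h k) (norm_div_le_sqrt_bergman z u k) (by positivity) hC
    _ = n * C * √(bergman z u) := by simp [mul_assoc]

theorem norm_fderiv_single_le {f : (Fin n → ℂ) → ℂ} {z : Fin n → ℂ} (hz : z ∈ polydisk n)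
    (k : Fin n) (a : ℂ) :
    ‖fderiv ℂ f z (Pi.single k a)‖ ≤ Q f z * (‖a‖ / (1 - ‖z k‖ ^ 2)) := by
  refine (norm_fderiv_le_Q_mul hz _).trans (mul_le_mul_of_nonneg_left ?_ (Q_nonneg f z))
  refine (sqrt_bergman_le_sum hz _).trans_eq ?_
  rw [Finset.sum_eq_single k (fun j _ hj => by simp [hj]) (by simp), Pi.single_eq_same]

theorem fderiv_mul_apply {f g : (Fin n → ℂ) → ℂ} (hf : f ∈ Holo n) (hg : g ∈ Holo n)
    {z : Fin n → ℂ} (hz : z ∈ polydisk n) (u : Fin n → ℂ) :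
    fderiv ℂ (f * g) z u = f z * fderiv ℂ g z u + g z * fderiv ℂ f z u := by
  rw [fderiv_mul (Holo.differentiableAt hf hz) (Holo.differentiableAt hg hz)]
  simp

theorem Q_mul_le {f g : (Fin n → ℂ) → ℂ} (hf : f ∈ Holo n) (hg : g ∈ Holo n)
    {z : Fin n → ℂ} (hz : z ∈ polydisk n) :
    Q (f * g) z ≤ ‖f z‖ * Q g z + ‖g z‖ * Q f z := by
  have := Q_nonneg f z
  have := Q_nonneg g z
  refine Q_le_of_forall (by positivity) fun u => ?_
  rw [fderiv_mul_apply hf hg hz, add_mul, mul_assoc, mul_assoc]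
  refine norm_add_le_of_le ?_ ?_ <;> rw [norm_mul] <;>
    exact mul_le_mul_of_nonneg_left (norm_fderiv_le_Q_mul hz u) (norm_nonneg _)

/-- Solving the product rule for the term containing the derivative of `f`; used with `f = ψ` and
`g` a test function. -/
theorem norm_mul_Q_le {f g : (Fin n → ℂ) → ℂ} (hf : f ∈ Holo n) (hg : g ∈ Holo n)
    {z : Fin n → ℂ} (hz : z ∈ polydisk n) :
    ‖g z‖ * Q f z ≤ Q (f * g) z + ‖f z‖ * Q g z := by
  have h1 := Q_nonneg (f * g) z
  have h2 := Q_nonneg g z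
  rcases (norm_nonneg (g z)).eq_or_lt with h0 | h0
  · rw [← h0, zero_mul]
    positivity
  rw [← le_div_iff₀' h0]
  refine Q_le_of_forall (by positivity) fun u => ?_
  rw [div_mul_eq_mul_div, le_div_iff₀' h0, ← norm_mul,
    eq_sub_of_add_eq' (fderiv_mul_apply hf hg hz u).symm, add_mul, mul_assoc]
  refine norm_sub_le_of_le (norm_fderiv_le_Q_mul hz u) ?_
  rw [norm_mul]
  exact mul_le_mul_of_nonneg_left (norm_fderiv_le_Q_mul hz u) (norm_nonneg _)

/-! ### Logarithmic growth along radii. -/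

/-- The sum of the hyperbolic logarithms of the coordinates. -/
def logSum (z : Fin n → ℂ) : ℝ := ∑ k, Real.log ((1 + ‖z k‖) / (1 - ‖z k‖))

theorem log_ratio_nonneg {x : ℝ} (h0 : 0 ≤ x) (h1 : x < 1) :
    0 ≤ Real.log ((1 + x) / (1 - x)) := by
  refine Real.log_nonneg ?_
  rw [le_div_iff₀ (by linarith)]
  linarith

theorem logSum_nonneg {z : Fin n → ℂ} (hz : z ∈ polydisk n) : 0 ≤ logSum z :=
  Finset.sum_nonneg fun k _ => log_ratio_nonneg (norm_nonneg _) (hz k)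

theorem hasDerivAt_log_ratio {x : ℝ} (h0 : 0 ≤ x) (h1 : x < 1) :
    HasDerivAt (fun x : ℝ => Real.log ((1 + x) / (1 - x))) (2 / (1 - x ^ 2)) x := by
  have h2 : (1 - x) ≠ 0 := by linarith
  have h3 : (1 + x) ≠ 0 := by linarith
  have h4 : (1 - x ^ 2) ≠ 0 := by
    rw [show 1 - x ^ 2 = (1 - x) * (1 + x) by ring]
    exact mul_ne_zero h2 h3
  have := (((hasDerivAt_id x).const_add 1).div ((hasDerivAt_id x).const_sub 1) h2).log
    (div_ne_zero h3 h2)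
  refine this.congr_deriv ?_
  simp only [id, Pi.div_apply]
  field_simp
  ring

/-- A holomorphic function with `Q f ≤ ε` on `{r ≤ |z_k|}` grows at most like `ε` times the
logarithmic sum along the radii that start at the torus of radius `r`. -/
theorem exists_norm_sub_le_logSum {f : (Fin n → ℂ) → ℂ} (hf : f ∈ Holo n) {r ε : ℝ}
    (hr : 0 ≤ r) (hε : 0 ≤ ε)
    (hQ : ∀ z ∈ polydisk n, (∀ k, r ≤ ‖z k‖) → Q f z ≤ ε) {z : Fin n → ℂ}
    (hz : z ∈ polydisk n) (hrz : ∀ k, r ≤ ‖z k‖) :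
    ∃ w : Fin n → ℂ, (∀ k, ‖w k‖ = r) ∧ ‖f z - f w‖ ≤ ε * logSum z := by
  have hex : ∀ k, ∃ e : ℂ, ‖e‖ = 1 ∧ z k = ‖z k‖ * e := fun k => by
    by_cases h : z k = 0
    · exact ⟨1, by simp, by simp [h]⟩
    · have : (‖z k‖ : ℂ) ≠ 0 := by simpa using h
      exact ⟨z k / ‖z k‖, by simp [h], by field_simp⟩
  choose e he hze using hex
  -- The path keeps every argument fixed and moves every modulus linearly from `r` to `‖z k‖`, hence
  -- stays where `Q f ≤ ε`.
  set ρ : Fin n → ℝ → ℝ := fun k t => r + t * (‖z k‖ - r) with hρ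
  set γ : ℝ → Fin n → ℂ := fun t k => (ρ k t : ℂ) * e k with hγ
  have hρr : ∀ k, ∀ t ∈ Set.Icc (0 : ℝ) 1, r ≤ ρ k t := fun k t ht => by
    have := mul_nonneg ht.1 (sub_nonneg.2 (hrz k))
    simp only [hρ]; linarith
  have hρ1 : ∀ k, ∀ t ∈ Set.Icc (0 : ℝ) 1, ρ k t < 1 := fun k t ht => by
    have h1 : ‖z k‖ < 1 := hz k
    have := mul_le_of_le_one_left (sub_nonneg.2 (hrz k)) ht.2
    simp only [hρ]; linarith
  have hρd : ∀ k t, HasDerivAt (ρ k) (‖z k‖ - r) t := fun k t =>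
    (((hasDerivAt_id t).mul_const (‖z k‖ - r)).const_add r).congr_deriv (one_mul _)
  have hnorm : ∀ t ∈ Set.Icc (0 : ℝ) 1, ∀ k, ‖γ t k‖ = ρ k t := fun t ht k => by
    simp only [hγ, norm_mul, he, mul_one, Complex.norm_real, Real.norm_eq_abs]
    exact abs_of_nonneg (hr.trans (hρr k t ht))
  have hmem : ∀ t ∈ Set.Icc (0 : ℝ) 1, γ t ∈ polydisk n := fun t ht k => by
    rw [hnorm t ht k]; exact hρ1 k t ht
  have hγd : ∀ t, HasDerivAt γ (fun k => ((‖z k‖ - r : ℝ) : ℂ) * e k) t := fun t =>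
    hasDerivAt_pi.2 fun k => ((hρd k t).ofReal_comp).mul_const (e k)
  have hγ1 : γ 1 = z := by
    ext k
    simp only [hγ, hρ]
    rw [hze k]
    simp [he]
  have hfd : ∀ t ∈ Set.Icc (0 : ℝ) 1, HasDerivAt (fun t => f (γ t) - f (γ 0))
      (fderiv ℂ f (γ t) fun k => ((‖z k‖ - r : ℝ) : ℂ) * e k) t := fun t ht =>
    ((((Holo.differentiableAt hf (hmem t ht)).hasFDerivAt.restrictScalars ℝ).comp_hasDerivAt t
      (hγd t))).sub_const _
  -- Comparison function for the mean value inequality: nonnegative at `t = 0`, and its derivative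
  -- is `2 * ε` times the sum bounding the Bergman length of the velocity, so a factor 2 is to
  -- spare.
  have hBd : ∀ t ∈ Set.Icc (0 : ℝ) 1,
      HasDerivAt (fun t => ε * ∑ k, Real.log ((1 + ρ k t) / (1 - ρ k t)))
        (ε * ∑ k, 2 / (1 - ρ k t ^ 2) * (‖z k‖ - r)) t := fun t ht =>
    (HasDerivAt.fun_sum fun k _ => (hasDerivAt_log_ratio (hr.trans (hρr k t ht))
      (hρ1 k t ht)).comp t (hρd k t)).const_mul ε
  have h01 : ∀ t ∈ Set.Ico (0 : ℝ) 1, t ∈ Set.Icc (0 : ℝ) 1 := fun t ht => ⟨ht.1, ht.2.le⟩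
  have key := image_norm_le_of_norm_deriv_right_le_deriv_boundary' (a := (0 : ℝ)) (b := 1)
    (fun t ht => (hfd t ht).continuousAt.continuousWithinAt)
    (fun t ht => (hfd t (h01 t ht)).hasDerivWithinAt)
    (by
      simp only [sub_self, norm_zero]
      refine mul_nonneg hε (Finset.sum_nonneg fun k _ => ?_)
      have h0 : (0 : ℝ) ∈ Set.Icc (0 : ℝ) 1 := by simp
      exact log_ratio_nonneg (hr.trans (hρr k 0 h0)) (hρ1 k 0 h0))
    (fun t ht => (hBd t ht).continuousAt.continuousWithinAt)
    (fun t ht => (hBd t (h01 t ht)).hasDerivWithinAt)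
    (fun t ht => by
      have ht' := h01 t ht
      refine (norm_fderiv_le_Q_mul (hmem t ht') _).trans (mul_le_mul (hQ _ (hmem t ht')
        fun k => by rw [hnorm t ht' k]; exact hρr k t ht')
        ((sqrt_bergman_le_sum (hmem t ht') _).trans (Finset.sum_le_sum fun k _ => ?_))
        (Real.sqrt_nonneg _) hε)
      have hp := one_sub_sq_pos (hmem t ht') k
      rw [hnorm t ht' k] at hp ⊢
      have h3 := sub_nonneg.2 (hrz k)
      rw [norm_mul, he, mul_one, Complex.norm_real, Real.norm_of_nonneg h3, div_mul_eq_mul_div]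
      gcongr
      linarith)
    (Set.right_mem_Icc.2 zero_le_one)
  refine ⟨γ 0, fun k => ?_, ?_⟩
  · rw [hnorm 0 (by simp) k]; simp [hρ]
  · simpa [hγ1, hρ, logSum] using key

/-- Logarithmic growth of a holomorphic function with bounded `Q`. -/
theorem norm_le_add_mul_logSum {f : (Fin n → ℂ) → ℂ} (hf : f ∈ Holo n) {β : ℝ} (hβ : 0 ≤ β)
    (hQ : ∀ z ∈ polydisk n, Q f z ≤ β) {z : Fin n → ℂ} (hz : z ∈ polydisk n) :
    ‖f z‖ ≤ ‖f 0‖ + β * logSum z := by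
  obtain ⟨w, hw, h⟩ := exists_norm_sub_le_logSum hf le_rfl hβ (fun z hz _ => hQ z hz) hz
    (fun k => norm_nonneg _)
  have : w = 0 := funext fun k => norm_eq_zero.1 (hw k)
  subst this
  linarith [norm_sub_norm_le (f z) (f 0)]

/-! ### Neighbourhoods of the distinguished boundary. -/

/-- The torus is compact, so a neighbourhood contains a uniform thickening; projecting each
coordinate radially to the circle moves it by exactly `1 - ‖z k‖`. -/
theorem mem_nhdsSet_distinguishedBoundary_inf {s : Set (Fin n → ℂ)} :
    s ∈ 𝓝ˢ (distinguishedBoundary n) ⊓ 𝓟 (polydisk n) ↔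
      ∃ r : ℝ, 0 ≤ r ∧ r < 1 ∧ ∀ z ∈ polydisk n, (∀ k, r ≤ ‖z k‖) → z ∈ s := by
  have hcpt : IsCompact (distinguishedBoundary n) := by
    have : distinguishedBoundary n = Set.univ.pi fun _ => Metric.sphere (0 : ℂ) 1 := by
      ext z; simp [distinguishedBoundary]
    rw [this]
    exact isCompact_univ_pi fun _ => isCompact_sphere 0 1
  rw [mem_inf_principal]
  constructor
  · intro h
    obtain ⟨U, hUo, hU, hUs⟩ := mem_nhdsSet_iff_exists.1 h
    obtain ⟨δ, hδ, hδU⟩ := hcpt.exists_thickening_subset_open hUo hU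
    refine ⟨max 0 (1 - δ / 2), le_max_left _ _, max_lt one_pos (by linarith), fun z hz hr => ?_⟩
    refine hUs (hδU ?_) hz
    rw [Metric.mem_thickening_iff]
    have hex : ∀ k, ∃ e : ℂ, ‖e‖ = 1 ∧ ‖z k - e‖ = 1 - ‖z k‖ := fun k => by
      have h1 : ‖z k‖ < 1 := hz k
      by_cases h : z k = 0
      · exact ⟨1, by simp, by simp [h]⟩
      · have h0 : (‖z k‖ : ℂ) ≠ 0 := by simpa using h
        refine ⟨z k / ‖z k‖, by simp [h], ?_⟩
        rw [show z k - z k / ‖z k‖ = -((1 - ‖z k‖ : ℝ) : ℂ) * (z k / ‖z k‖) by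
          push_cast; field_simp; ring, norm_mul, norm_neg, Complex.norm_real,
          Real.norm_of_nonneg (by linarith)]
        simp [h]
    choose e he hze using hex
    refine ⟨e, he, ?_⟩
    refine lt_of_le_of_lt ((dist_pi_le_iff (by positivity : 0 ≤ δ / 2)).2 fun k => ?_)
      (by linarith : δ / 2 < δ)
    rw [dist_eq_norm, hze]
    linarith [(le_max_right 0 (1 - δ / 2)).trans (hr k)]
  · rintro ⟨r, -, hr1, h⟩
    refine mem_nhdsSet_iff_exists.2 ⟨{z | ∀ k, r < ‖z k‖}, ?_, fun z hz k => ?_,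
      fun z hz hzD => h z hzD fun k => (hz k).le⟩
    · simp only [Set.ofPred_forall]
      exact isOpen_iInter_of_finite fun k => isOpen_lt continuous_const (by fun_prop)
    · rw [hz k]; exact hr1

theorem tendsto_Q_iff {f : (Fin n → ℂ) → ℂ} :
    Tendsto (Q f) (𝓝ˢ (distinguishedBoundary n) ⊓ 𝓟 (polydisk n)) (𝓝 0) ↔
      ∀ ε > 0, ∃ r : ℝ, 0 ≤ r ∧ r < 1 ∧ ∀ z ∈ polydisk n, (∀ k, r ≤ ‖z k‖) → Q f z ≤ ε := by
  rw [Metric.nhds_basis_closedBall.tendsto_right_iff]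
  refine forall₂_congr fun ε _ => ?_
  simp only [Filter.Eventually, mem_nhdsSet_distinguishedBoundary_inf, Set.mem_ofPred_eq,
    Metric.mem_closedBall, dist_zero_right, Real.norm_of_nonneg (Q_nonneg f _)]

/-! ### The extended Bloch norm in terms of real bounds. -/

theorem blochNorm_le {f : (Fin n → ℂ) → ℂ} {β : ℝ} (hβ : 0 ≤ β)
    (hQ : ∀ z ∈ polydisk n, Q f z ≤ β) : blochNorm f ≤ ENNReal.ofReal (‖f 0‖ + β) := by
  rw [blochNorm, ENNReal.ofReal_add (norm_nonneg _) hβ, ofReal_norm]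
  gcongr
  exact iSup₂_le fun z hz => ENNReal.ofReal_le_ofReal (hQ z hz)

theorem mem_Bloch_of_Q_le {f : (Fin n → ℂ) → ℂ} (hf : f ∈ Holo n) {β : ℝ}
    (hQ : ∀ z ∈ polydisk n, Q f z ≤ β) : f ∈ Bloch n :=
  ⟨hf, (iSup₂_le fun z hz => ENNReal.ofReal_le_ofReal (hQ z hz)).trans_lt
    (ENNReal.ofReal_lt_top (r := β))⟩

theorem exists_blochNorm_eq {f : (Fin n → ℂ) → ℂ} (hf : f ∈ Bloch n) :
    ∃ β : ℝ, 0 ≤ β ∧ (∀ z ∈ polydisk n, Q f z ≤ β) ∧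
      blochNorm f = ENNReal.ofReal (‖f 0‖ + β) := by
  refine ⟨(blochSeminorm f).toReal, ENNReal.toReal_nonneg, fun z hz => ?_, ?_⟩
  · rw [← ENNReal.ofReal_le_iff_le_toReal hf.2.ne]
    exact le_iSup₂ (f := fun z (_ : z ∈ polydisk n) => ENNReal.ofReal (Q f z)) z hz
  · rw [ENNReal.ofReal_add (norm_nonneg _) ENNReal.toReal_nonneg, ofReal_norm,
      ENNReal.ofReal_toReal hf.2.ne, blochNorm]

theorem le_of_blochNorm_le {f : (Fin n → ℂ) → ℂ} {M : ℝ} (hM : 0 ≤ M)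
    (h : blochNorm f ≤ ENNReal.ofReal M) :
    ‖f 0‖ ≤ M ∧ ∀ z ∈ polydisk n, Q f z ≤ M := by
  constructor
  · rw [← ENNReal.ofReal_le_ofReal_iff hM, ofReal_norm]
    exact le_self_add.trans h
  · intro z hz
    rw [← ENNReal.ofReal_le_ofReal_iff hM]
    exact ((le_iSup₂ (f := fun z (_ : z ∈ polydisk n) => ENNReal.ofReal (Q f z)) z hz).trans
      le_add_self).trans h

theorem Q_one (z : Fin n → ℂ) : Q (1 : (Fin n → ℂ) → ℂ) z = 0 := by
  simp [Q]

theorem one_mem_Holo : (1 : (Fin n → ℂ) → ℂ) ∈ Holo n :=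
  differentiableOn_const (c := (1 : ℂ))

theorem one_mem_Bloch : (1 : (Fin n → ℂ) → ℂ) ∈ Bloch n :=
  mem_Bloch_of_Q_le one_mem_Holo fun z _ => (Q_one z).le

theorem one_mem_StarLittleBloch : (1 : (Fin n → ℂ) → ℂ) ∈ StarLittleBloch n :=
  ⟨one_mem_Holo, tendsto_const_nhds.congr fun z => (Q_one z).symm⟩

theorem blochNorm_one : blochNorm (1 : (Fin n → ℂ) → ℂ) ≤ 1 := by
  simpa using blochNorm_le le_rfl fun z _ => (Q_one (n := n) z).le

/-! ### Logarithmic test functions. -/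

/-- A logarithmic function of the coordinate `z_k` that peaks in the direction of `a`. -/
def logTest (k : Fin n) (a : ℂ) (z : Fin n → ℂ) : ℂ :=
  Real.log 4 - Complex.log (1 - starRingEnd ℂ a * z k)

section logTest

variable {k : Fin n} {a : ℂ} {z : Fin n → ℂ}

theorem one_sub_le_norm_one_sub_conj_mul (a w : ℂ) :
    1 - ‖a‖ * ‖w‖ ≤ ‖1 - starRingEnd ℂ a * w‖ := by
  simpa using norm_sub_norm_le 1 (starRingEnd ℂ a * w)

theorem hasFDerivAt_logTest (ha : ‖a‖ < 1) (hz : z ∈ polydisk n) :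
    HasFDerivAt (logTest k a) ((starRingEnd ℂ a / (1 - starRingEnd ℂ a * z k)) •
      (ContinuousLinearMap.proj k : (Fin n → ℂ) →L[ℂ] ℂ)) z := by
  have hw : ‖z k‖ < 1 := hz k
  have hs : 1 - starRingEnd ℂ a * z k ∈ Complex.slitPlane := by
    refine Or.inl ?_
    have h1 := Complex.re_le_norm (starRingEnd ℂ a * z k)
    rw [norm_mul, RCLike.norm_conj] at h1
    rw [Complex.sub_re, Complex.one_re]
    nlinarith [norm_nonneg a, norm_nonneg (z k)]
  have h := ((((hasDerivAt_id (z k)).const_mul (starRingEnd ℂ a)).const_sub 1).clog hs).const_sub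
    ((Real.log 4 : ℝ) : ℂ)
  have h2 := h.comp_hasFDerivAt z
    (ContinuousLinearMap.proj k : (Fin n → ℂ) →L[ℂ] ℂ).hasFDerivAt
  refine h2.congr_fderiv ?_
  congr 1
  simp [neg_div]

theorem logTest_mem_Holo (ha : ‖a‖ < 1) : logTest k a ∈ Holo n := fun _ hz =>
  (hasFDerivAt_logTest ha hz).differentiableAt.differentiableWithinAt

theorem Q_logTest_le (ha : ‖a‖ < 1) (hz : z ∈ polydisk n) :
    Q (logTest k a) z ≤ (1 - ‖z k‖ ^ 2) / (1 - ‖a‖ * ‖z k‖) := by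
  have hw : ‖z k‖ < 1 := hz k
  have hp := one_sub_sq_pos hz k
  have hd : 0 < 1 - ‖a‖ * ‖z k‖ := by nlinarith [norm_nonneg a, norm_nonneg (z k)]
  refine Q_le_of_forall (by positivity) fun u => ?_
  rw [(hasFDerivAt_logTest ha hz).fderiv]
  simp only [_root_.smul_apply, ContinuousLinearMap.proj_apply, smul_eq_mul,
    norm_mul, norm_div, RCLike.norm_conj]
  calc ‖a‖ / ‖1 - starRingEnd ℂ a * z k‖ * ‖u k‖ ≤ 1 / (1 - ‖a‖ * ‖z k‖) * ‖u k‖ := by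
        gcongr
        exact one_sub_le_norm_one_sub_conj_mul a (z k)
    _ = (1 - ‖z k‖ ^ 2) / (1 - ‖a‖ * ‖z k‖) * (‖u k‖ / (1 - ‖z k‖ ^ 2)) := by field_simp
    _ ≤ _ := mul_le_mul_of_nonneg_left (norm_div_le_sqrt_bergman z u k) (by positivity)

/-- The bound does not depend on `a`, because `1 - x ^ 2 ≤ 2 * (1 - x) ≤ 2 * (1 - ‖a‖ * x)` for `x =
‖z k‖`. -/
theorem Q_logTest_le_two (ha : ‖a‖ < 1) (hz : z ∈ polydisk n) : Q (logTest k a) z ≤ 2 := by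
  have hw : ‖z k‖ < 1 := hz k
  have hd : 0 < 1 - ‖a‖ * ‖z k‖ := by nlinarith [norm_nonneg a, norm_nonneg (z k)]
  refine (Q_logTest_le ha hz).trans ((div_le_iff₀ hd).2 ?_)
  nlinarith [norm_nonneg a, norm_nonneg (z k), sq_nonneg (1 - ‖z k‖)]

theorem logTest_mem_Bloch (ha : ‖a‖ < 1) : logTest k a ∈ Bloch n :=
  mem_Bloch_of_Q_le (logTest_mem_Holo ha) fun _ hz => Q_logTest_le_two ha hz

/-- For fixed `a` the denominator in `Q_logTest_le` stays above `1 - ‖a‖`, while the numerator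
vanishes as `‖z k‖ → 1`. -/
theorem logTest_mem_StarLittleBloch (ha : ‖a‖ < 1) : logTest k a ∈ StarLittleBloch n := by
  refine ⟨logTest_mem_Holo ha, tendsto_Q_iff.2 fun ε hε => ?_⟩
  have ha' : 0 < 1 - ‖a‖ := by linarith
  have hpos : 0 < ε * (1 - ‖a‖) / 2 := by positivity
  refine ⟨max 0 (1 - ε * (1 - ‖a‖) / 2), le_max_left _ _, max_lt one_pos (by linarith),
    fun z hz hr => (Q_logTest_le ha hz).trans ?_⟩
  have hw : ‖z k‖ < 1 := hz k
  have h1 := (le_max_right 0 (1 - ε * (1 - ‖a‖) / 2)).trans (hr k)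
  have hd : 1 - ‖a‖ ≤ 1 - ‖a‖ * ‖z k‖ := by nlinarith [norm_nonneg a, norm_nonneg (z k)]
  rw [div_le_iff₀ (ha'.trans_le hd)]
  calc 1 - ‖z k‖ ^ 2 ≤ 2 * (1 - ‖z k‖) := by nlinarith [norm_nonneg (z k)]
    _ ≤ ε * (1 - ‖a‖) := by linarith
    _ ≤ _ := by gcongr

theorem blochNorm_logTest_le (ha : ‖a‖ < 1) :
    blochNorm (logTest k a) ≤ ENNReal.ofReal (Real.log 4 + 2) := by
  have h := blochNorm_le zero_le_two fun z hz => Q_logTest_le_two (k := k) ha (z := z) hz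
  have h0 : logTest k a 0 = ((Real.log 4 : ℝ) : ℂ) := by simp [logTest]
  rwa [h0, Complex.norm_real, Real.norm_of_nonneg (Real.log_nonneg (by norm_num))] at h

/-- This is where the constant `log 4` is needed: `(1 + x) / (1 - x) ≤ 4 / (1 - x ^ 2)` because `(1
+ x) ^ 2 ≤ 4`. -/
theorem log_ratio_le_norm_logTest (hz : z ∈ polydisk n) :
    Real.log ((1 + ‖z k‖) / (1 - ‖z k‖)) ≤ ‖logTest k (z k) z‖ := by
  have hw : ‖z k‖ < 1 := hz k
  have h0 := norm_nonneg (z k)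
  have hp := one_sub_sq_pos hz k
  have h1 : (1 - starRingEnd ℂ (z k) * z k) = ((1 - ‖z k‖ ^ 2 : ℝ) : ℂ) := by
    rw [Complex.conj_mul']; push_cast; rfl
  rw [logTest, h1, ← Complex.ofReal_log hp.le, ← Complex.ofReal_sub, Complex.norm_real]
  refine le_trans ?_ (le_abs_self _)
  rw [← Real.log_div (by norm_num) hp.ne']
  have h2 : 0 < 1 - ‖z k‖ := by linarith
  refine Real.log_le_log (by positivity) ?_
  rw [div_le_div_iff₀ h2 hp]
  nlinarith [mul_nonneg h2.le (sub_nonneg.2 hw.le), mul_nonneg h2.le h0, mul_nonneg (mul_nonneg h2.le h0) h2.le,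
    mul_nonneg (mul_nonneg h2.le h0) h0]

end logTest

/-! ### Necessity of (c). -/

/-- Iterating on `1` gives `‖ψ z‖ ^ m ≤ C ^ m * (1 + logSum z)`; the factor depending on `z` does
not grow with `m`, so `‖ψ z‖` cannot exceed `C`. -/
theorem MulBoundedOn.exists_norm_le {ψ : (Fin n → ℂ) → ℂ} {X : Set ((Fin n → ℂ) → ℂ)}
    (h : MulBoundedOn ψ X) (hX : X ⊆ Holo n) (h1 : 1 ∈ X) :
    ∃ C : ℝ, ∀ z ∈ polydisk n, ‖ψ z‖ ≤ C := by
  obtain ⟨hmap, C, hC⟩ := h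
  have hpow : ∀ m : ℕ, ψ ^ m ∈ X ∧ blochNorm (ψ ^ m) ≤ (C : ℝ≥0∞) ^ m := fun m => by
    induction m with
    | zero => simpa using ⟨h1, blochNorm_one⟩
    | succ m ih =>
      rw [pow_succ']
      refine ⟨hmap _ ih.1, (hC _ ih.1).trans ?_⟩
      rw [pow_succ']
      gcongr
      exact ih.2
  -- The maximum with 1 only ensures a positive divisor.
  refine ⟨max C 1, fun z hz => ?_⟩
  set C' : ℝ := max C 1
  have hC' : 0 < C' := lt_max_of_lt_right one_pos
  by_contra! hlt
  obtain ⟨m, hm⟩ := pow_unbounded_of_one_lt (1 + logSum z) ((one_lt_div hC').2 hlt)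
  have hpC : (0 : ℝ) ≤ C' ^ m := by positivity
  have hle : blochNorm (ψ ^ m) ≤ ENNReal.ofReal (C' ^ m) := by
    refine (hpow m).2.trans ?_
    rw [ENNReal.ofReal_pow hC'.le]
    gcongr
    rw [← ENNReal.ofReal_coe_nnreal]
    exact ENNReal.ofReal_le_ofReal (le_max_left _ _)
  obtain ⟨h2, h3⟩ := le_of_blochNorm_le hpC hle
  have h4 := norm_le_add_mul_logSum (hX (hpow m).1) hpC h3 hz
  rw [Pi.pow_apply, norm_pow] at h4
  rw [div_pow, lt_div_iff₀ (by positivity)] at hm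
  linarith

theorem MulBoundedOn.bddAbove {ψ : (Fin n → ℂ) → ℂ} {X : Set ((Fin n → ℂ) → ℂ)}
    (hψ : ψ ∈ Holo n) (h : MulBoundedOn ψ X) (hX : X ⊆ Holo n) (h1 : 1 ∈ X)
    (hlog : ∀ k a, ‖a‖ < 1 → logTest k a ∈ X) :
    ψ ∈ HInfty n ∧ BddAbove ((fun z => logSum z * Q ψ z) '' polydisk n) := by
  obtain ⟨S, hS⟩ := h.exists_norm_le hX h1
  refine ⟨⟨hψ, S, hS⟩, ?_⟩
  obtain ⟨-, C, hC⟩ := h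
  have h4 : 0 ≤ Real.log 4 := Real.log_nonneg (by norm_num)
  refine ⟨n * (C * (Real.log 4 + 2) + S * 2), ?_⟩
  rintro _ ⟨z, hz, rfl⟩
  simp only [logSum, Finset.sum_mul]
  refine (Finset.sum_le_card_nsmul _ _ (C * (Real.log 4 + 2) + S * 2) fun k _ => ?_).trans_eq
    (by simp [-mul_eq_mul_left_iff, mul_add])
  have ha : ‖z k‖ < 1 := hz k
  have hS0 : 0 ≤ S := (norm_nonneg _).trans (hS z hz)
  have hb : blochNorm (ψ * logTest k (z k)) ≤ ENNReal.ofReal (C * (Real.log 4 + 2)) := by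
    rw [ENNReal.ofReal_mul C.coe_nonneg, ENNReal.ofReal_coe_nnreal]
    refine (hC _ (hlog k _ ha)).trans ?_
    gcongr
    exact blochNorm_logTest_le ha
  calc Real.log ((1 + ‖z k‖) / (1 - ‖z k‖)) * Q ψ z ≤ ‖logTest k (z k) z‖ * Q ψ z :=
        mul_le_mul_of_nonneg_right (log_ratio_le_norm_logTest hz) (Q_nonneg _ _)
    _ ≤ Q (ψ * logTest k (z k)) z + ‖ψ z‖ * Q (logTest k (z k)) z :=
        norm_mul_Q_le hψ (logTest_mem_Holo ha) hz
    _ ≤ C * (Real.log 4 + 2) + S * 2 :=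
        add_le_add ((le_of_blochNorm_le (by positivity) hb).2 z hz)
          (mul_le_mul (hS z hz) (Q_logTest_le_two ha hz) (Q_nonneg _ _) hS0)

/-! ### Maximum modulus and the inclusion of the `*`-little Bloch space in the Bloch space. -/

/-- Maximum modulus principle, applied in each variable: coordinates of modulus less than `R` can
be pushed out to the circle of radius `R` without decreasing `‖G‖`. -/
theorem exists_norm_eq_max_and_norm_le {G : (Fin n → ℂ) → ℂ} {ρ : Fin n → ℝ}
    (hG : DifferentiableOn ℂ G {z | ∀ k, ‖z k‖ < ρ k}) {R : ℝ} (hR : 0 < R)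
    (hρ : ∀ k, R < ρ k) {z : Fin n → ℂ} (hz : ∀ k, ‖z k‖ < ρ k) :
    ∃ w : Fin n → ℂ, (∀ k, ‖w k‖ = max R ‖z k‖) ∧ ‖G z‖ ≤ ‖G w‖ := by
  suffices h : ∀ s : Finset (Fin n), ∃ w : Fin n → ℂ, (∀ k ∈ s, ‖w k‖ = max R ‖z k‖) ∧
      (∀ k ∉ s, w k = z k) ∧ ‖G z‖ ≤ ‖G w‖ by
    obtain ⟨w, h1, -, h2⟩ := h Finset.univ
    exact ⟨w, fun k => h1 k (Finset.mem_univ k), h2⟩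
  intro s
  induction s using Finset.induction_on with
  | empty => exact ⟨z, by simp, fun _ _ => rfl, le_rfl⟩
  | insert j s hj ih =>
    obtain ⟨w, hw1, hw2, hw3⟩ := ih
    have hwρ : ∀ k, ‖w k‖ < ρ k := fun k => by
      by_cases hk : k ∈ s
      · rw [hw1 k hk]; exact max_lt (hρ k) (hz k)
      · rw [hw2 k hk]; exact hz k
    rcases le_or_gt R ‖z j‖ with hRj | hRj
    · refine ⟨w, fun k hk => ?_, fun k hk => hw2 k fun h => hk (Finset.mem_insert_of_mem h), hw3⟩
      rcases Finset.mem_insert.1 hk with rfl | hk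
      · rw [hw2 _ hj, max_eq_right hRj]
      · exact hw1 k hk
    · have hd : DiffContOnCl ℂ (fun ζ => G (Function.update w j ζ)) (Metric.ball 0 R) := by
        refine DifferentiableOn.diffContOnCl ?_
        rw [closure_ball 0 hR.ne']
        refine hG.comp (fun ζ _ => (hasFDerivAt_update w ζ).differentiableAt.differentiableWithinAt)
          fun ζ hζ k => ?_
        rcases eq_or_ne k j with rfl | hk
        · rw [Function.update_self]
          exact (mem_closedBall_zero_iff.1 hζ).trans_lt (hρ k)
        · rw [Function.update_of_ne hk]
          exact hwρ k
      obtain ⟨ζ, hζ, hmax⟩ := Complex.exists_mem_frontier_isMaxOn_norm Metric.isBounded_ball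
        (Metric.nonempty_ball.2 hR) hd
      rw [frontier_ball 0 hR.ne', mem_sphere_zero_iff_norm] at hζ
      have hmem : w j ∈ closure (Metric.ball (0 : ℂ) R) := subset_closure (by
        rw [mem_ball_zero_iff, hw2 j hj]; exact hRj)
      have hle := hmax hmem
      simp only [Set.mem_ofPred_eq, Function.comp_apply, Function.update_eq_self] at hle
      refine ⟨Function.update w j ζ, fun k hk => ?_, fun k hk => ?_, hw3.trans hle⟩
      · rcases eq_or_ne k j with rfl | hkj
        · rw [Function.update_self, hζ, max_eq_left hRj.le]
        · rw [Function.update_of_ne hkj]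
          exact hw1 k ((Finset.mem_insert.1 hk).resolve_left hkj)
      · rw [Finset.mem_insert, not_or] at hk
        rw [Function.update_of_ne hk.1]
        exact hw2 k hk.2

theorem norm_add_single_le (w : Fin n → ℂ) (j k : Fin n) (a : ℂ) :
    ‖(w + Pi.single k a : Fin n → ℂ) j‖ ≤ ‖w j‖ + ‖a‖ := by
  refine (norm_add_le _ _).trans (add_le_add_right ?_ _)
  exact (norm_le_pi_norm _ j).trans_eq (Pi.norm_single _)

theorem sub_le_norm_add_single (w : Fin n → ℂ) (j k : Fin n) (a : ℂ) :
    ‖w j‖ - ‖a‖ ≤ ‖(w + Pi.single k a : Fin n → ℂ) j‖ := by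
  refine le_trans (sub_le_sub_left ?_ _) (norm_sub_le_norm_add _ _)
  exact (norm_le_pi_norm _ j).trans_eq (Pi.norm_single _)

theorem hasDerivAt_comp_add_single {f : (Fin n → ℂ) → ℂ} (hf : f ∈ Holo n) {z : Fin n → ℂ}
    {k : Fin n} {ζ : ℂ} (h : z + Pi.single k ζ ∈ polydisk n) :
    HasDerivAt (fun ζ => f (z + Pi.single k ζ))
      (fderiv ℂ f (z + Pi.single k ζ) (Pi.single k 1)) ζ :=
  (Holo.differentiableAt hf h).hasFDerivAt.comp_hasDerivAt ζ ((hasDerivAt_single k ζ).const_add z)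

/-- If `Q f ≤ 1` near the distinguished boundary, then the increments of `f` in a coordinate
direction are controlled on the whole polydisk, by the maximum modulus principle. -/
theorem norm_add_single_sub_le {f : (Fin n → ℂ) → ℂ} (hf : f ∈ Holo n) {r R : ℝ}
    (hr1 : r < 1) (hRr : R = (1 + r) / 2) (hR0 : 0 < R)
    (hr : ∀ z ∈ polydisk n, (∀ k, r ≤ ‖z k‖) → Q f z ≤ 1) {z : Fin n → ℂ} (hz : z ∈ polydisk n)
    (k : Fin n) {h : ℂ} (hh : ‖h‖ ≤ (1 - max R ‖z k‖) / 2) :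
    ‖f (z + Pi.single k h) - f z‖ ≤ 2 / (1 - max R ‖z k‖) * ‖h‖ := by
  have hzk : ‖z k‖ < 1 := hz k
  have hR1 : R < 1 := by linarith
  set m : ℝ := max R ‖z k‖ with hm
  have hm1 : m < 1 := max_lt hR1 hzk
  have hRm : R ≤ m := le_max_left _ _
  have hzm : ‖z k‖ ≤ m := le_max_right _ _
  -- Shrinking only the `k`-th radius by `‖h‖` keeps the shifted point in the polydisk, so the
  -- increment by the fixed `h` is holomorphic in the base point and the maximum principle applies
  -- to it.
  set ρ : Fin n → ℝ := fun j => if j = k then 1 - ‖h‖ else 1 with hρ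
  have hsub : ∀ w : Fin n → ℂ, (∀ j, ‖w j‖ < ρ j) → ∀ a : ℂ, ‖a‖ ≤ ‖h‖ →
      w + Pi.single k a ∈ polydisk n := fun w hw a ha j => by
    have := hw j
    rcases eq_or_ne j k with rfl | hjk
    · simp only [hρ, if_true] at this
      exact (norm_add_single_le w j j a).trans_lt (by linarith)
    · simpa [hρ, hjk] using this
  have hG : DifferentiableOn ℂ (fun w => f (w + Pi.single k h) - f w)
      {w | ∀ j, ‖w j‖ < ρ j} := by
    refine DifferentiableOn.sub (hf.comp (by fun_prop) fun w hw => hsub w hw h le_rfl)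
      (hf.mono fun w hw => ?_)
    simpa using hsub w hw 0 (by simp)
  have hρR : ∀ j, R < ρ j := fun j => by
    simp only [hρ]; split_ifs <;> linarith
  have hzρ : ∀ j, ‖z j‖ < ρ j := fun j => by
    simp only [hρ]
    split_ifs with hj
    · rw [hj]; linarith
    · exact hz j
  obtain ⟨w, hw, hle⟩ := exists_norm_eq_max_and_norm_le hG hR0 hρR hzρ
  refine hle.trans ?_
  have hwρ : ∀ j, ‖w j‖ < ρ j := fun j => by rw [hw j]; exact max_lt (hρR j) (hzρ j)
  have hmv := Convex.norm_image_sub_le_of_norm_hasDerivWithin_le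
    (f := fun ζ => f (w + Pi.single k ζ)) (s := Metric.closedBall (0 : ℂ) ‖h‖)
    (C := 2 / (1 - m)) (x := 0) (y := h)
    (fun ζ hζ => (hasDerivAt_comp_add_single hf
      (hsub w hwρ ζ (mem_closedBall_zero_iff.1 hζ))).hasDerivWithinAt)
    (fun ζ hζ => ?_) (convex_closedBall _ _) (by simp) (by simp)
  · simpa using hmv
  · rw [mem_closedBall_zero_iff] at hζ
    have hmem := hsub w hwρ ζ hζ
    have hwm : ‖w k‖ = m := hw k
    have hlt := norm_add_single_le w k k ζ
    -- In direction `k` the modulus is at least `m - (1 - m) / 2 ≥ (3 * R - 1) / 2 = (1 + 3 * r) / 4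
    -- ≥ r`, which is what the midpoint `R` provides.
    have hge : ∀ j, r ≤ ‖(w + Pi.single k ζ : Fin n → ℂ) j‖ := fun j => by
      rcases eq_or_ne j k with rfl | hjk
      · have := sub_le_norm_add_single w j j ζ
        rw [hwm] at this
        linarith
      · have : R ≤ ‖w j‖ := by rw [hw j]; exact le_max_left _ _
        simp only [Pi.add_apply, Pi.single_eq_of_ne hjk, add_zero]
        linarith
    rw [hwm] at hlt
    generalize w + Pi.single k ζ = v at hmem hge hlt ⊢
    -- Here `‖v k‖ ≤ m + (1 - m) / 2 = (1 + m) / 2`.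
    have hlow : (1 - m) / 2 ≤ 1 - ‖v k‖ ^ 2 := by nlinarith [norm_nonneg (v k)]
    have hm2 : 0 < (1 - m) / 2 := by linarith
    calc ‖fderiv ℂ f v (Pi.single k 1)‖ ≤ Q f v * (‖(1 : ℂ)‖ / (1 - ‖v k‖ ^ 2)) :=
          norm_fderiv_single_le hmem k 1
      _ ≤ 1 * (1 / ((1 - m) / 2)) := by
          rw [norm_one]
          exact mul_le_mul (hr v hmem hge) (one_div_le_one_div_of_le hm2 hlow)
            (one_div_nonneg.2 (hm2.le.trans hlow)) zero_le_one
      _ = 2 / (1 - m) := by rw [one_mul, one_div_div]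

/-- Functions in the `*`-little Bloch space are Bloch functions. -/
theorem StarLittleBloch_subset_Bloch : StarLittleBloch n ⊆ Bloch n := by
  rintro f ⟨hf, hlim⟩
  obtain ⟨r, hr0, hr1, hr⟩ := tendsto_Q_iff.1 hlim 1 one_pos
  set R : ℝ := (1 + r) / 2 with hRdef
  have hR0 : 0 < R := by positivity
  have hR1 : R < 1 := by linarith
  refine mem_Bloch_of_Q_le hf (β := n * (4 / (1 - R))) fun z hz =>
    Q_le_of_forall_single hz (by have := sub_pos.2 hR1; positivity) fun k => ?_
  set m : ℝ := max R ‖z k‖ with hm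
  have hzk : ‖z k‖ < 1 := hz k
  have hm1 : m < 1 := max_lt hR1 hzk
  have hderiv : ‖fderiv ℂ f z (Pi.single k 1)‖ ≤ 2 / (1 - m) := by
    have hd := hasDerivAt_comp_add_single hf (z := z) (k := k) (ζ := 0) (by simpa using hz)
    rw [Pi.single_zero, add_zero] at hd
    have hm' : 0 < 1 - m := by linarith
    -- Increments bounded by a multiple of `‖h‖` for small `h` bound the derivative by the same
    -- factor.
    refine hd.le_of_lip' (by positivity) ?_
    filter_upwards [Metric.closedBall_mem_nhds (0 : ℂ) (half_pos hm')] with h hh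
    simpa using norm_add_single_sub_le hf hr1 hRdef hR0 hr hz k (mem_closedBall_zero_iff.1 hh)
  have hm' : 0 < 1 - m := by linarith
  have hR' : 0 < 1 - R := by linarith
  have hk : (1 - ‖z k‖ ^ 2) * (1 - R) ≤ 2 * (1 - m) := by
    have h1 : 1 - ‖z k‖ ^ 2 ≤ 2 * (1 - ‖z k‖) := by nlinarith [norm_nonneg (z k)]
    rcases max_cases R ‖z k‖ with ⟨h, -⟩ | ⟨h, -⟩
    · rw [hm, h]; nlinarith [norm_nonneg (z k)]
    · rw [hm, h]; nlinarith [norm_nonneg (z k)]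
  calc (1 - ‖z k‖ ^ 2) * ‖fderiv ℂ f z (Pi.single k 1)‖
      ≤ (1 - ‖z k‖ ^ 2) * (2 / (1 - m)) :=
        mul_le_mul_of_nonneg_left hderiv (one_sub_sq_pos hz k).le
    _ ≤ 4 / (1 - R) := by
        rw [← mul_div_assoc, div_le_div_iff₀ hm' hR']
        linarith

/-! ### Sufficiency of (c). -/

/-- A bounded holomorphic function has bounded `Q`, by the Cauchy estimates. -/
theorem Q_le_of_forall_norm_le {f : (Fin n → ℂ) → ℂ} (hf : f ∈ Holo n) {S : ℝ}
    (hS : ∀ z ∈ polydisk n, ‖f z‖ ≤ S) {z : Fin n → ℂ} (hz : z ∈ polydisk n) :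
    Q f z ≤ n * (4 * S) := by
  have hS0 : 0 ≤ S := (norm_nonneg _).trans (hS z hz)
  refine Q_le_of_forall_single hz (by positivity) fun k => ?_
  have hzk : ‖z k‖ < 1 := hz k
  have hpos : 0 < (1 - ‖z k‖) / 2 := by linarith
  have hmem : ∀ ζ : ℂ, ‖ζ‖ ≤ (1 - ‖z k‖) / 2 → z + Pi.single k ζ ∈ polydisk n :=
    fun ζ hζ j => by
      rcases eq_or_ne j k with rfl | hjk
      · exact (norm_add_single_le z j j ζ).trans_lt (by linarith)
      · simpa [hjk] using hz j
  have hd := hasDerivAt_comp_add_single hf (hmem 0 (by simpa using hpos.le))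
  have hcauchy : ‖deriv (fun ζ => f (z + Pi.single k ζ)) 0‖ ≤ S / ((1 - ‖z k‖) / 2) := by
    refine Complex.norm_deriv_le_of_forall_mem_sphere_norm_le hpos
      (DifferentiableOn.diffContOnCl ?_) fun ζ hζ => hS _ (hmem ζ ?_)
    · rw [closure_ball _ hpos.ne']
      exact fun ζ hζ => (hasDerivAt_comp_add_single hf
        (hmem ζ (mem_closedBall_zero_iff.1 hζ))).differentiableAt.differentiableWithinAt
    · exact (mem_sphere_zero_iff_norm.1 hζ).le
  rw [hd.deriv, Pi.single_zero, add_zero] at hcauchy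
  have h1 : 1 - ‖z k‖ ^ 2 ≤ 4 * ((1 - ‖z k‖) / 2) := by nlinarith [norm_nonneg (z k)]
  calc (1 - ‖z k‖ ^ 2) * ‖fderiv ℂ f z (Pi.single k 1)‖
      ≤ 4 * ((1 - ‖z k‖) / 2) * (S / ((1 - ‖z k‖) / 2)) := by gcongr
    _ = 4 * S := by rw [mul_assoc, mul_div_cancel₀ _ hpos.ne']

theorem mulBoundedOn_Bloch {ψ : (Fin n → ℂ) → ℂ} (hψ : ψ ∈ HInfty n)
    (hB : BddAbove ((fun z => logSum z * Q ψ z) '' polydisk n)) :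
    MulBoundedOn ψ (Bloch n) := by
  obtain ⟨hψ, S, hS⟩ := hψ
  obtain ⟨B, hB⟩ := hB
  have hB : ∀ z ∈ polydisk n, logSum z * Q ψ z ≤ B := fun z hz => hB ⟨z, hz, rfl⟩
  have h0 : (0 : Fin n → ℂ) ∈ polydisk n := fun k => by simp
  have hS0 : 0 ≤ S := (norm_nonneg _).trans (hS 0 h0)
  have hB0 : 0 ≤ B := (mul_nonneg (logSum_nonneg h0) (Q_nonneg _ _)).trans (hB 0 h0)
  -- The explicit dependence on `‖f 0‖` and `β` is what gives the operator bound as well as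
  -- invariance.
  have hQ : ∀ f ∈ Holo n, ∀ β : ℝ, 0 ≤ β → (∀ z ∈ polydisk n, Q f z ≤ β) →
      ∀ z ∈ polydisk n, Q (ψ * f) z ≤ S * β + (‖f 0‖ * (n * (4 * S)) + β * B) := by
    intro f hf β hβ hQf z hz
    refine (Q_mul_le hψ hf hz).trans (add_le_add
      (mul_le_mul (hS z hz) (hQf z hz) (Q_nonneg _ _) hS0) ?_)
    calc ‖f z‖ * Q ψ z ≤ (‖f 0‖ + β * logSum z) * Q ψ z :=
          mul_le_mul_of_nonneg_right (norm_le_add_mul_logSum hf hβ hQf hz) (Q_nonneg _ _)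
      _ = ‖f 0‖ * Q ψ z + β * (logSum z * Q ψ z) := by ring
      _ ≤ _ := by
          have h1 := Q_le_of_forall_norm_le hψ hS hz
          have h2 := hB z hz
          gcongr
  refine ⟨fun f hf => ?_, (S + n * (4 * S) + B).toNNReal, fun f hf => ?_⟩
  · obtain ⟨β, hβ, hQf, -⟩ := exists_blochNorm_eq hf
    exact mem_Bloch_of_Q_le (Holo.mul hψ hf.1) (hQ f hf.1 β hβ hQf)
  · obtain ⟨β, hβ, hQf, hnorm⟩ := exists_blochNorm_eq hf
    change _ ≤ ENNReal.ofReal (S + n * (4 * S) + B) * _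
    rw [hnorm, ← ENNReal.ofReal_mul (by positivity)]
    refine (blochNorm_le (by positivity) (hQ f hf.1 β hβ hQf)).trans (ENNReal.ofReal_le_ofReal ?_)
    have h1 : ‖(ψ * f) 0‖ ≤ S * ‖f 0‖ := by
      rw [Pi.mul_apply, norm_mul]
      exact mul_le_mul_of_nonneg_right (hS 0 h0) (norm_nonneg _)
    have h2 : 0 ≤ n * (4 * S) * β + B * ‖f 0‖ := by positivity
    linarith

/-- `Q ψ` vanishes at the distinguished boundary if `logSum * Q ψ` is bounded. -/
theorem exists_Q_le_of_logSum_mul_Q_le {ψ : (Fin n → ℂ) → ℂ} {B : ℝ}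
    (hB : ∀ z ∈ polydisk n, logSum z * Q ψ z ≤ B) {ε : ℝ} (hε : 0 < ε) :
    ∃ r : ℝ, 0 ≤ r ∧ r < 1 ∧ ∀ z ∈ polydisk n, (∀ k, r ≤ ‖z k‖) → Q ψ z ≤ ε := by
  have h0 : (0 : Fin n → ℂ) ∈ polydisk n := fun k => by simp
  have hB0 : 0 ≤ B := (mul_nonneg (logSum_nonneg h0) (Q_nonneg _ _)).trans (hB 0 h0)
  set K : ℝ := B / ε + 1 with hK
  have hK0 : 0 < K := by positivity
  -- If `‖z k‖ ≥ 1 - exp (-K)` for a single `k`, that term of `logSum` is already at least `K > B /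
  -- ε`.
  refine ⟨1 - Real.exp (-K), ?_, by linarith [Real.exp_pos (-K)], fun z hz hr => ?_⟩
  · linarith [Real.exp_le_one_iff.2 (neg_nonpos.2 hK0.le)]
  -- For `n = 0` the sum is empty and gives nothing, but `Q` vanishes.
  rcases isEmpty_or_nonempty (Fin n) with hn | ⟨⟨k⟩⟩
  · refine Q_le_of_forall hε.le fun u => ?_
    rw [Subsingleton.elim u 0, map_zero, norm_zero]
    positivity
  · have hzk : ‖z k‖ < 1 := hz k
    have hKL : K ≤ logSum z := by
      refine le_trans ?_ (Finset.single_le_sum (fun j _ => log_ratio_nonneg (norm_nonneg _) (hz j))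
        (Finset.mem_univ k))
      rw [Real.le_log_iff_exp_le (div_pos (by positivity) (by linarith)),
        le_div_iff₀ (by linarith)]
      calc Real.exp K * (1 - ‖z k‖) ≤ Real.exp K * Real.exp (-K) := by
            gcongr
            linarith [hr k]
        _ = 1 := by rw [← Real.exp_add, add_neg_cancel, Real.exp_zero]
        _ ≤ _ := by linarith [norm_nonneg (z k)]
    have h1 : K * Q ψ z ≤ K * ε := by
      calc K * Q ψ z ≤ logSum z * Q ψ z := mul_le_mul_of_nonneg_right hKL (Q_nonneg _ _)
        _ ≤ B := hB z hz
        _ ≤ K * ε := by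
          rw [hK, add_mul, div_mul_cancel₀ _ hε.ne']
          linarith
    exact le_of_mul_le_mul_left h1 hK0

theorem mul_mem_StarLittleBloch {ψ : (Fin n → ℂ) → ℂ} (hψ : ψ ∈ HInfty n)
    (hB : BddAbove ((fun z => logSum z * Q ψ z) '' polydisk n)) {f : (Fin n → ℂ) → ℂ}
    (hf : f ∈ StarLittleBloch n) : ψ * f ∈ StarLittleBloch n := by
  obtain ⟨hψ, S, hS⟩ := hψ
  obtain ⟨B, hB⟩ := hB
  have hB : ∀ z ∈ polydisk n, logSum z * Q ψ z ≤ B := fun z hz => hB ⟨z, hz, rfl⟩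
  have h0 : (0 : Fin n → ℂ) ∈ polydisk n := fun k => by simp
  have hS0 : 0 ≤ S := (norm_nonneg _).trans (hS 0 h0)
  have hB0 : 0 ≤ B := (mul_nonneg (logSum_nonneg h0) (Q_nonneg _ _)).trans (hB 0 h0)
  obtain ⟨hfH, hlim⟩ := hf
  refine ⟨Holo.mul hψ hfH, tendsto_Q_iff.2 fun ε hε => ?_⟩
  -- Three contributions `S * δ`, `δ` and `δ * B` will add up to `ε`.
  set δ : ℝ := ε / (S + B + 1) with hδ
  have hδ0 : 0 < δ := by positivity
  obtain ⟨r, hr0, hr1, hr⟩ := tendsto_Q_iff.1 hlim δ hδ0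
  obtain ⟨M, hM0, hM⟩ : ∃ M : ℝ, 0 ≤ M ∧ ∀ w : Fin n → ℂ, (∀ k, ‖w k‖ = r) → ‖f w‖ ≤ M := by
    have hsub : Metric.closedBall (0 : Fin n → ℂ) r ⊆ polydisk n := fun w hw k =>
      ((norm_le_pi_norm w k).trans (mem_closedBall_zero_iff.1 hw)).trans_lt hr1
    obtain ⟨M, hM⟩ := (isCompact_closedBall (0 : Fin n → ℂ) r).exists_bound_of_continuousOn
      (DifferentiableOn.continuousOn hfH |>.mono hsub)
    refine ⟨M, (norm_nonneg _).trans (hM 0 (by simpa using hr0)), fun w hw => hM w ?_⟩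
    exact mem_closedBall_zero_iff.2 ((pi_norm_le_iff_of_nonneg hr0).2 fun k => (hw k).le)
  -- The smallness of `Q ψ` absorbs the constant part `M + 1` of the bound on `f`; the part `δ *
  -- logSum` is absorbed by (c).
  obtain ⟨s, hs0, hs1, hs⟩ := exists_Q_le_of_logSum_mul_Q_le hB
    (show 0 < δ / (M + 1) by positivity)
  refine ⟨max r s, hr0.trans (le_max_left _ _), max_lt hr1 hs1, fun z hz hrs => ?_⟩
  have hrz : ∀ k, r ≤ ‖z k‖ := fun k => (le_max_left r s).trans (hrs k)
  obtain ⟨w, hw, hle⟩ := exists_norm_sub_le_logSum hfH hr0 hδ0.le hr hz hrz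
  have hfz : ‖f z‖ ≤ (M + 1) + δ * logSum z := by
    linarith [norm_sub_norm_le (f z) (f w), hM w hw]
  have hQψ := hs z hz fun k => (le_max_right r s).trans (hrs k)
  calc Q (ψ * f) z ≤ ‖ψ z‖ * Q f z + ‖f z‖ * Q ψ z := Q_mul_le hψ hfH hz
    _ ≤ S * δ + ((M + 1) + δ * logSum z) * Q ψ z :=
        add_le_add (mul_le_mul (hS z hz) (hr z hz hrz) (Q_nonneg _ _) hS0)
          (mul_le_mul_of_nonneg_right hfz (Q_nonneg _ _))
    _ = S * δ + ((M + 1) * Q ψ z + δ * (logSum z * Q ψ z)) := by ring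
    _ ≤ S * δ + ((M + 1) * (δ / (M + 1)) + δ * B) := by
        have := hB z hz
        gcongr
    _ = ε := by rw [hδ]; field_simp; ring

end PolydiskBloch

end

theorem mainTheorem6 (n : ℕ) (ψ : (Fin n → ℂ) → ℂ) (hψ : ψ ∈ PolydiskBloch.Holo n) :
    List.TFAE
      [PolydiskBloch.MulBoundedOn ψ (PolydiskBloch.Bloch n),
       PolydiskBloch.MulBoundedOn ψ (PolydiskBloch.StarLittleBloch n),
       ψ ∈ PolydiskBloch.HInfty n ∧
         BddAbove ((fun z : Fin n → ℂ =>
           (∑ k, Real.log ((1 + ‖z k‖) / (1 - ‖z k‖))) * PolydiskBloch.Q ψ z) ''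
             PolydiskBloch.polydisk n)] := by
  tfae_have 1 → 3 := fun h => h.bddAbove hψ (fun _ hf => hf.1) PolydiskBloch.one_mem_Bloch
    fun _ _ ha => PolydiskBloch.logTest_mem_Bloch ha
  tfae_have 2 → 3 := fun h => h.bddAbove hψ (fun _ hf => hf.1)
    PolydiskBloch.one_mem_StarLittleBloch fun _ _ ha => PolydiskBloch.logTest_mem_StarLittleBloch ha
  tfae_have 3 → 1 := fun h => PolydiskBloch.mulBoundedOn_Bloch h.1 h.2
  tfae_have 3 → 2 := fun h =>
    ⟨fun _ hf => PolydiskBloch.mul_mem_StarLittleBloch h.1 h.2 hf,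
      (PolydiskBloch.mulBoundedOn_Bloch h.1 h.2).2.imp fun _ hC f hf =>
        hC f (PolydiskBloch.StarLittleBloch_subset_Bloch hf)⟩
  tfae_finish
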